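/- **Conventions.** $[S]^\omega$ is the family of countably infinite subsets of $S$. A family $\mathcal E\subseteq[S]^\omega$ is *club* if every $Z\in[S]^\omega$ is contained in some $Y\in\mathcal E$, and $\bigcup_n Y_n\in\mathcal E$ whenever $Y_0\subseteq Y_1\subseteq\cdots$ are in $\mathcal E$. For a regular cardinal $\theta$, $H(\theta)$ is the structure whose domain is the collection of sets with transitive closure of size $<\theta$, equipped with $\in$ and a fixed well-ordering of this domain. The *Ellentuck topology* on $[X]^\omega$ has as open sets the unions of sets of the form $[x,N]=\{Y\in[X]^\omega: x\subseteq Y\subseteq N\}$ with $N\in[X]^\omega$ and $x\subseteq N$ finite. For a countable $M\prec H(\theta)$, a set $\Sigma\subseteq[X]^\omega$ is *$M$-stationary* if $\Sigma\cap\mathcal E\cap M\neq\emptyset$ for every club $\mathcal E\subseteq[X]^\omega$ with $\mathcal E\in M$. **MRP.** An *open stationary set mapping* is a function $\Sigma$ for which there are an uncountable set $X$ and a regular cardinal $\theta$ with $[X]^\omega\in H(\theta)$ such that the domain of $\Sigma$ is a club in $[H(\theta)]^\omega$ consisting of countable elementary submodels $M\prec H(\theta)$ with $X\in M$, and for each such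 $M$ the set $\Sigma(M)\subseteq[X]^\omega$ is open in the Ellentuck topology and $M$-stationary. The *mapping reflection principle* MRP asserts that for every open stationary set mapping $\Sigma$ (with $X,\theta$ as above) there is a continuous $\in$-chain $(N_\xi:\xi<\omega_1)$ of members of the domain of $\Sigma$ (that is, $N_\xi\in N_\eta$ for $\xi<\eta<\omega_1$, and $N_\xi=\bigcup_{\eta<\xi}N_\eta$ for limit $0<\xi<\omega_1$) such that for every limit ordinal $0<\xi<\omega_1$ there is $\nu<\xi$ with $N_\eta\cap X\in\Sigma(N_\xi)$ for all $\eta$ with $\nu<\eta<\xi$. **Covering matrices.** Let $\lambda<\kappa$ be regular cardinals. A family $\mathcal D=(K(\alpha,\beta):\alpha<\lambda,\ \beta<\kappa)$ of sets of ordinals is a *$\lambda$-covering matrix for $\kappa$* if 1. $\beta\subseteq\bigcup_{\alpha<\lambda}K(\alpha,\beta)$ for all $\beta<\kappa$; 2. $|K(\alpha,\beta)|<\kappa$ for all $\alpha<\lambda$ and $\beta<\kappa$; 3. $K(\alpha,\beta)\subseteq K(\eta,\beta)$ for all $\beta<\kappa$ and $\alpha<\eta<\lambda$; 4. for all $\gamma<\beta<\kappa$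 and $\alpha<\lambda$ there is $\eta<\lambda$ with $K(\alpha,\gamma)\subseteq K(\eta,\beta)$; 5. for every $X\subseteq\kappa$ with $|X|\le\lambda$ there is $\gamma_X<\kappa$ such that for all $\beta<\kappa$ and $\eta<\lambda$ there is $\alpha<\lambda$ with $K(\eta,\beta)\cap X\subseteq K(\alpha,\gamma_X)$. A *covering matrix* is an $\omega$-covering matrix. **Theorem.** Assume MRP. Let $\kappa>\aleph_1$ be a regular cardinal and let $\mathcal D=(K(n,\beta):n<\omega,\ \beta<\kappa)$ be a covering matrix for $\kappa$ such that every $K(n,\beta)$ is a closed set of ordinals (in the order topology). Then there is an unbounded $A\subseteq\kappa$ such that $[A]^\omega$ is covered by $\mathcal D$, that is, every countably infinite $X\subseteq A$ is contained in $K(n,\beta)$ for some $n<\omega$ and $\beta<\kappa$. -/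

import Mathlib

open Cardinal Ordinal Set

universe u

namespace ReflectionCovering

/-- The cardinality of the transitive closure of `x` is that of the set of all `y` from which `x` is
reached by finitely many (at least one) membership steps. `H θ` collects the sets whose transitive
closure has size less than `θ`. -/
def H (θ : Cardinal.{u}) : Set ZFSet.{u} :=
  {x | #{y : ZFSet.{u} // Relation.TransGen (fun a b : ZFSet.{u} => a ∈ b) y x} <
    Cardinal.lift.{u + 1} θ}

/-- The relation symbols of the language with two binary relations: membership and an order. -/
inductive SetRel : ℕ → Type
  | mem : SetRel 2
  | lt : SetRel 2

/-- The first-order language with two binary relation symbols and no function symbols. -/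
def setLang : FirstOrder.Language.{0, 0} :=
  ⟨fun _ => Empty, SetRel⟩

/-- The structure `⟨H(θ), ∈, <⟩`, where `<` is a fixed well-ordering of `H(θ)`. -/
noncomputable instance structureH (θ : Cardinal.{u}) : setLang.Structure (H θ) where
  funMap := fun f _ => Empty.elim f
  RelMap := fun r v =>
    match r, v with
    | SetRel.mem, v => (v 0).1 ∈ (v 1).1
    | SetRel.lt, v => WellOrderingRel (v 0) (v 1)

/-- `M ≺ H(θ)`: the set `M` is the domain of an elementary substructure of `⟨H(θ), ∈, <⟩`. -/
def IsElementaryIn (θ : Cardinal.{u}) (M : ZFSet.{u}) : Prop :=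
  ∃ S : setLang.ElementarySubstructure (H θ),
    (M : Set ZFSet.{u}) = Subtype.val '' (S : Set (H θ))

/-- `[S]^ω`, the countably infinite subsets of `S`. -/
def omegaSubsets (S : Set ZFSet.{u}) : Set ZFSet.{u} :=
  {Y | (Y : Set ZFSet.{u}) ⊆ S ∧ Y.card = ℵ₀}

/-- For a set `X`, the collection `[X]^ω` as a set. -/
noncomputable def omegaPowerset (X : ZFSet.{u}) : ZFSet.{u} :=
  X.powerset.sep fun Y => Y.card = ℵ₀

/-- `E ⊆ [S]^ω` is closed and unbounded. -/
structure IsClubIn (S : Set ZFSet.{u}) (E : Set ZFSet.{u}) : Prop where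
  subset : E ⊆ omegaSubsets S
  unbounded : ∀ Z ∈ omegaSubsets S, ∃ Y ∈ E, Z ⊆ Y
  closed : ∀ Y : ℕ → ZFSet.{u}, (∀ n, Y n ∈ E) → (∀ n, Y n ⊆ Y (n + 1)) →
    ∀ Z : ZFSet.{u}, (∀ z, z ∈ Z ↔ ∃ n, z ∈ Y n) → Z ∈ E

/-- The basic set `[x, N] = {Y ∈ [X]^ω : x ⊆ Y ⊆ N}` of the Ellentuck topology. -/
def ellentuckBasic (X : ZFSet.{u}) (x : Set ZFSet.{u}) (N : ZFSet.{u}) : Set ZFSet.{u} :=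
  {Y | Y ∈ omegaSubsets (X : Set ZFSet.{u}) ∧ x ⊆ (Y : Set ZFSet.{u}) ∧ Y ⊆ N}

/-- `U ⊆ [X]^ω` is open in the Ellentuck topology: it is a union of sets `[x, N]` with
`N ∈ [X]^ω` and `x ⊆ N` finite. -/
def IsEllentuckOpen (X : ZFSet.{u}) (U : Set ZFSet.{u}) : Prop :=
  ∃ B : Set (Set ZFSet.{u}),
    (∀ b ∈ B, ∃ N ∈ omegaSubsets (X : Set ZFSet.{u}), ∃ x : Set ZFSet.{u},
      x.Finite ∧ x ⊆ (N : Set ZFSet.{u}) ∧ b = ellentuckBasic X x N) ∧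
    U = ⋃₀ B

/-- `U ⊆ [X]^ω` is `M`-stationary: it meets `E ∩ M` for every club `E ⊆ [X]^ω` with `E ∈ M`. -/
def IsMStationary (X M : ZFSet.{u}) (U : Set ZFSet.{u}) : Prop :=
  ∀ E ∈ M, IsClubIn (X : Set ZFSet.{u}) (E : Set ZFSet.{u}) → ∃ Y ∈ U, Y ∈ E ∧ Y ∈ M

/-- `F`, with domain `dom`, is an open stationary set mapping for `X` and `θ`. -/
structure IsOpenStationaryMapping (X : ZFSet.{u}) (θ : Cardinal.{u}) (dom : Set ZFSet.{u})
    (F : ZFSet.{u} → Set ZFSet.{u}) : Prop where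
  uncountable : ℵ₀ < X.card
  regular : θ.IsRegular
  mem_H : omegaPowerset X ∈ H θ
  club : IsClubIn (H θ) dom
  elementary : ∀ M ∈ dom, IsElementaryIn θ M
  mem_dom : ∀ M ∈ dom, X ∈ M
  subset : ∀ M ∈ dom, F M ⊆ omegaSubsets (X : Set ZFSet.{u})
  isOpen : ∀ M ∈ dom, IsEllentuckOpen X (F M)
  stationary : ∀ M ∈ dom, IsMStationary X M (F M)

/-- `(N ξ : ξ < ω₁)` is a continuous `∈`-chain of members of `dom` that reflects `F`. -/
structure IsReflectingSequence (X : ZFSet.{u}) (dom : Set ZFSet.{u})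
    (F : ZFSet.{u} → Set ZFSet.{u}) (N : Ordinal.{u} → ZFSet.{u}) : Prop where
  mem_dom : ∀ ξ < ω₁, N ξ ∈ dom
  chain : ∀ ξ η, ξ < η → η < ω₁ → N ξ ∈ N η
  continuous : ∀ ξ < ω₁, Order.IsSuccLimit ξ → ∀ z, z ∈ N ξ ↔ ∃ η < ξ, z ∈ N η
  reflects : ∀ ξ < ω₁, Order.IsSuccLimit ξ →
    ∃ ν < ξ, ∀ η, ν < η → η < ξ → N η ∩ X ∈ F (N ξ)

/-- The mapping reflection principle. -/
def MRP : Prop :=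
  ∀ (X : ZFSet.{u}) (θ : Cardinal.{u}) (dom : Set ZFSet.{u}) (F : ZFSet.{u} → Set ZFSet.{u}),
    IsOpenStationaryMapping X θ dom F →
      ∃ N : Ordinal.{u} → ZFSet.{u}, IsReflectingSequence X dom F N

/-- `(K α β : α < lam, β < κ)` is a `lam`-covering matrix for `κ`; the values of `K` at other
indices play no role. -/
structure IsCoveringMatrix (lam κ : Cardinal.{u})
    (K : Ordinal.{u} → Ordinal.{u} → Set Ordinal.{u}) : Prop where
  regular_left : lam.IsRegular
  regular_right : κ.IsRegular
  lt : lam < κ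
  cover : ∀ β < κ.ord, ∀ ξ < β, ∃ α < lam.ord, ξ ∈ K α β
  small : ∀ α < lam.ord, ∀ β < κ.ord, #(K α β) < Cardinal.lift.{u + 1} κ
  mono : ∀ β < κ.ord, ∀ α η, α < η → η < lam.ord → K α β ⊆ K η β
  coherent : ∀ γ β, γ < β → β < κ.ord → ∀ α < lam.ord, ∃ η < lam.ord, K α γ ⊆ K η β
  trace : ∀ X : Set Ordinal.{u}, X ⊆ Iio κ.ord → #X ≤ Cardinal.lift.{u + 1} lam →
    ∃ γ < κ.ord, ∀ β < κ.ord, ∀ η < lam.ord, ∃ α < lam.ord, K η β ∩ X ⊆ K α γ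

end ReflectionCovering

namespace ReflectionCovering

/-! Suppose that no unbounded subset of `κ` is covered. For a countable `M ≺ H(θ)` let `γ_M` be a
column tracing the whole matrix on `M ∩ κ`, let `s_M` enumerate `M ∩ κ`, and let the height of an
ordinal be the first index at which `s_M` reaches it. Let `Σ(M)` consist of the `Y` whose supremum
has a height `h` and lies outside `K(h, γ_M)`.

`Σ(M)` is open because the entries are closed (`exists_mem_forall_notMem_of_isClosed`). It is
`M`-stationary because the suprema of members of a club `E ∈ M` form an unbounded set. By
assumption, countably many of these suprema lie together in no entry. A sequence of members
witnessing this can be taken inside `M`, its suprema are bounded by some `τ ∈ M ∩ κ`, and one of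
them avoids `K(h, γ_M)` for `h` the height of `τ`. Its own height is at most `h`, so monotonicity
finishes.

A reflecting chain gives `δ_ξ = sup (N_ξ ∩ κ)`, all below one `β < κ` since `κ > ℵ₁`. Some `K(n, β)`
contains `δ_ζ` for `ζ` cofinal in a limit `ξ`. The trace property puts these `δ_ζ` in a single `K(m,
γ)`, where `γ` is the column of `N_ξ`. Their heights eventually exceed `m`, contradicting reflection
(`false_of_reflection`). -/

open FirstOrder

/-! ### Clubs of elementary submodels. -/

/-- Function symbols of a language with countably many unary functions. -/
inductive UnaryFun : ℕ → Type
  | app : ℕ → UnaryFun 1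

/-- The language with countably many unary function symbols. -/
def unaryLang : FirstOrder.Language.{0, 0} :=
  ⟨UnaryFun, fun _ => Empty⟩

instance : Countable (Σ n, unaryLang.Functions n) := by
  refine Function.Surjective.countable (f := fun i : ℕ => (⟨1, UnaryFun.app i⟩ :
    Σ n, unaryLang.Functions n)) ?_
  rintro ⟨_, ⟨i⟩⟩
  exact ⟨i, rfl⟩

/-- The structure on `A` given by a sequence of unary functions. -/
@[reducible] def unaryStructure {A : Type*} (f : ℕ → A → A) : unaryLang.Structure A where
  funMap := fun g v => match g, v with
    | UnaryFun.app i, v => f i (v 0)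
  RelMap := fun r _ => Empty.elim r

instance : Countable setLang.Symbols := by
  have h : Countable (Σ n, SetRel n) := by
    refine Function.Surjective.countable (f := fun b : Bool => (⟨2, bif b then .mem else .lt⟩ :
      Σ n, SetRel n)) ?_
    rintro ⟨_, _ | _⟩
    exacts [⟨true, rfl⟩, ⟨false, rfl⟩]
  have h' : IsEmpty (Σ n, setLang.Functions n) := ⟨fun f => Empty.elim f.2⟩
  exact inferInstanceAs (Countable ((Σ n, setLang.Functions n) ⊕ (Σ n, SetRel n)))

theorem countable_functions_skolem_unary :
    Countable (Σ n, ((setLang.sum setLang.skolem₁).sum unaryLang).Functions n) := by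
  have h1 : Countable (Σ n, (setLang.sum setLang.skolem₁).Functions n) := by
    rw [← mk_le_aleph0_iff]
    refine Language.card_functions_sum_skolem₁_le.trans (max_le le_rfl ?_)
    exact mk_le_aleph0_iff.2 inferInstance
  have h2 : Countable (Σ n, unaryLang.Functions n) := inferInstance
  exact Countable.of_equiv _ (Equiv.sigmaSumDistrib (setLang.sum setLang.skolem₁).Functions
    unaryLang.Functions).symm

theorem card_eq_aleph0_iff {Y : ZFSet.{u}} :
    Y.card = ℵ₀ ↔ (Y : Set ZFSet.{u}).Countable ∧ (Y : Set ZFSet.{u}).Infinite := by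
  have h : #(Y : Set ZFSet.{u}) = lift.{u + 1, u} Y.card := ZFSet.cardinalMk_coe_sort
  rw [← Cardinal.lift_inj.{u, u + 1}, ← h, Cardinal.lift_aleph0, le_antisymm_iff,
    Cardinal.mk_le_aleph0_iff, ← Cardinal.infinite_iff, Set.countable_coe_iff, Set.infinite_coe_iff]

theorem mem_omegaSubsets {S : Set ZFSet.{u}} {Y : ZFSet.{u}} :
    Y ∈ omegaSubsets S ↔ (Y : Set ZFSet.{u}) ⊆ S ∧ (Y : Set ZFSet.{u}).Countable ∧
      (Y : Set ZFSet.{u}).Infinite := by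
  rw [omegaSubsets, mem_ofPred_eq, card_eq_aleph0_iff]

theorem exists_coe_eq_of_countable {S : Set ZFSet.{u}} (hS : S.Countable) :
    ∃ Y : ZFSet.{u}, (Y : Set ZFSet.{u}) = S := by
  have := hS.to_subtype
  refine ⟨ZFSet.range (fun x : S => x.1), ?_⟩
  ext z
  simp

/-- The countable elementary submodels of `H θ` closed under countably many given functions
contain a club. -/
theorem exists_club_elementary (θ : Cardinal.{u}) (hθ : (H θ).Nonempty)
    (Φ : ℕ → ZFSet.{u} → ZFSet.{u}) :
    ∃ dom : Set ZFSet.{u}, IsClubIn (H θ) dom ∧ ∀ M ∈ dom, IsElementaryIn θ M ∧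
      ∀ x ∈ M, ∀ i, Φ i x ∈ H θ → Φ i x ∈ M := by
  classical
  have : Nonempty (H θ) := hθ.to_subtype
  let _ : unaryLang.Structure (H θ) :=
    -- The default value `x` makes the operation total on `H θ` without adding closure requirements.
    unaryStructure fun i x => if h : Φ i x ∈ H θ then ⟨Φ i x, h⟩ else x
  have hcount := countable_functions_skolem_unary
  let L := (setLang.sum setLang.skolem₁).sum unaryLang
  -- With Skolem functions in the language, elementarity follows from closure under functions, which
  -- passes to unions of chains.
  refine ⟨{M | M ∈ omegaSubsets (H θ) ∧ ∃ S : L.Substructure (H θ),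
    (M : Set ZFSet.{u}) = Subtype.val '' (S : Set (H θ))}, ⟨fun M hM => hM.1, ?_, ?_⟩, ?_⟩
  · intro Z hZ
    rw [mem_omegaSubsets] at hZ
    obtain ⟨hZ1, hZ2, hZ3⟩ := hZ
    let Z' : Set (H θ) := Subtype.val ⁻¹' (Z : Set ZFSet.{u})
    have hZ' : Z'.Countable := hZ2.preimage Subtype.val_injective
    let S : L.Substructure (H θ) := Language.Substructure.closure L Z'
    have hS : (S : Set (H θ)).Countable := by
      have h : Countable S := Set.Countable.substructure_closure L (s := Z') hZ'
      exact h
    obtain ⟨M, hM⟩ := exists_coe_eq_of_countable (hS.image Subtype.val)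
    have hZM : (Z : Set ZFSet.{u}) ⊆ M := by
      intro z hz
      rw [hM]
      exact ⟨⟨z, hZ1 hz⟩, Language.Substructure.subset_closure hz, rfl⟩
    refine ⟨M, ⟨mem_omegaSubsets.2 ⟨?_, ?_, hZ3.mono hZM⟩, S, hM⟩, fun z hz => hZM hz⟩
    · rw [hM]
      rintro _ ⟨x, -, rfl⟩
      exact x.2
    · rw [hM]
      exact hS.image _
  · intro Y hY hmono Z hZ
    choose hY1 S hS using hY
    have hZU : (Z : Set ZFSet.{u}) = ⋃ n, (Y n : Set ZFSet.{u}) := by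
      ext z
      simpa using hZ z
    have hSmono : Monotone S := by
      refine monotone_nat_of_le_succ fun n x hx => ?_
      have h1 : x.1 ∈ (Y n : Set ZFSet.{u}) := by
        rw [hS]
        exact ⟨x, hx, rfl⟩
      have h2 : x.1 ∈ (Y (n + 1) : Set ZFSet.{u}) := hmono n h1
      rw [hS] at h2
      obtain ⟨y, hy, hyx⟩ := h2
      rwa [← Subtype.ext hyx]
    refine ⟨mem_omegaSubsets.2 ⟨?_, ?_, ?_⟩, ⨆ n, S n, ?_⟩
    · rw [hZU]
      exact iUnion_subset fun n => (hY1 n).1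
    · rw [hZU]
      exact countable_iUnion fun n => (mem_omegaSubsets.1 (hY1 n)).2.1
    · rw [hZU]
      exact (mem_omegaSubsets.1 (hY1 0)).2.2.mono (subset_iUnion (fun n => (Y n : Set ZFSet.{u})) 0)
    · rw [hZU]
      have h : ((⨆ n, S n : L.Substructure (H θ)) : Set (H θ)) = ⋃ n, (S n : Set (H θ)) := by
        ext x
        simpa using Language.Substructure.mem_iSup_of_directed hSmono.directed_le
      rw [h, image_iUnion]
      exact iUnion_congr hS
  · rintro M ⟨hM, S, hS⟩
    refine ⟨⟨(Language.LHom.sumInl.substructureReduct S).elementarySkolem₁Reduct, hS⟩,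
      fun x hx i hi => ?_⟩
    have hx' : x ∈ (M : Set ZFSet.{u}) := hx
    rw [hS] at hx'
    obtain ⟨y, hy, rfl⟩ := hx'
    have h := S.fun_mem (Sum.inr (UnaryFun.app i) : L.Functions 1) (fun _ => y) fun _ => hy
    have h' : (if h : Φ i y ∈ H θ then ⟨Φ i y, h⟩ else y) ∈ S := h
    rw [dif_pos hi] at h'
    change _ ∈ (M : Set ZFSet.{u})
    rw [hS]
    exact ⟨_, h', rfl⟩

/-! ### The sets `H θ` and suprema below a regular cardinal. -/

theorem mem_H_of_mem {θ : Cardinal.{u}} {x y : ZFSet.{u}} (hx : x ∈ H θ) (hy : y ∈ x) :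
    y ∈ H θ := by
  rw [H, mem_ofPred_eq] at hx ⊢
  refine lt_of_le_of_lt ?_ hx
  exact mk_le_mk_of_subset fun z hz => Relation.TransGen.tail hz hy

/-- The transitive closure of `x` lies in the von Neumann stage at the rank of `x`, so a successor
cardinal above the size of that stage works. -/
theorem exists_isRegular_mem_H (x : ZFSet.{u}) : ∃ θ : Cardinal.{u}, θ.IsRegular ∧ x ∈ H θ := by
  let c := (ZFSet.vonNeumann x.rank).card
  refine ⟨Order.succ (max ℵ₀ c), isRegular_succ (le_max_left _ _), ?_⟩
  have hsub : {y : ZFSet.{u} | Relation.TransGen (fun a b : ZFSet.{u} => a ∈ b) y x} ⊆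
      (ZFSet.vonNeumann x.rank : Set ZFSet.{u}) := by
    intro y hy
    change y ∈ ZFSet.vonNeumann x.rank
    rw [ZFSet.mem_vonNeumann]
    induction hy using Relation.TransGen.head_induction_on with
    | single h => exact ZFSet.rank_lt_of_mem h
    | head h _ ih => exact (ZFSet.rank_lt_of_mem h).trans ih
  have h1 := mk_le_mk_of_subset hsub
  have h2 : #(ZFSet.vonNeumann x.rank : Set ZFSet.{u}) = lift.{u + 1, u} c :=
    ZFSet.cardinalMk_coe_sort
  refine lt_of_le_of_lt (h1.trans_eq h2) ?_
  rw [Cardinal.lift_lt]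
  exact Order.lt_succ_of_le (le_max_right _ _)

theorem sSup_lt_ord_of_isRegular {κ : Cardinal.{u}} (hκ : κ.IsRegular) {D : Set Ordinal.{u}}
    (hD : D ⊆ Iio κ.ord) (hcard : #D < lift.{u + 1} κ) : sSup D < κ.ord := by
  refine Ordinal.sSup_lt_of_lt_cof ?_ hD
  rwa [← Ordinal.lift_cof, hκ.cof_ord]

theorem bddAbove_of_subset_Iio {o : Ordinal.{u}} {D : Set Ordinal.{u}} (hD : D ⊆ Iio o) :
    BddAbove D :=
  ⟨o, fun _ ha => (hD ha).le⟩

/-! ### Heights of ordinals along a sequence. -/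

/-- The least index of a term of the sequence `s` that is at least `a`. -/
noncomputable def height (s : ℕ → Ordinal.{u}) (a : Ordinal.{u}) : ℕ :=
  sInf {n | a ≤ s n}

theorem le_apply_height {s : ℕ → Ordinal.{u}} {a : Ordinal.{u}} (h : ∃ k, a ≤ s k) :
    a ≤ s (height s a) :=
  Nat.sInf_mem (s := {n | a ≤ s n}) h

theorem height_le_of_le {s : ℕ → Ordinal.{u}} {a : Ordinal.{u}} {k : ℕ} (h : a ≤ s k) :
    height s a ≤ k :=
  Nat.sInf_le (s := {n | a ≤ s n}) h

theorem apply_lt_of_lt_height {s : ℕ → Ordinal.{u}} {a : Ordinal.{u}} {i : ℕ}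
    (h : i < height s a) : s i < a := by
  by_contra! hi
  exact (height_le_of_le hi).not_gt h

theorem height_mono {s : ℕ → Ordinal.{u}} {a b : Ordinal.{u}} (hab : a ≤ b)
    (h : ∃ k, b ≤ s k) : height s a ≤ height s b :=
  height_le_of_le (hab.trans (le_apply_height h))

theorem lt_height {s : ℕ → Ordinal.{u}} {a : Ordinal.{u}} {m : ℕ} (h : ∃ k, a ≤ s k)
    (hs : ∀ i ≤ m, s i < a) : m < height s a := by
  by_contra! hm
  exact (hs _ hm).not_ge (le_apply_height h)

theorem exists_forall_lt_of_lt_sSup {D : Set Ordinal.{u}} (hD : D.Nonempty)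
    (s : ℕ → Ordinal.{u}) (n : ℕ) (hs : ∀ i < n, s i < sSup D) : ∃ d ∈ D, ∀ i < n, s i < d := by
  induction n with
  | zero => exact ⟨hD.some, hD.some_mem, by simp⟩
  | succ n ih =>
    obtain ⟨d, hd, h⟩ := ih fun i hi => hs i (by lia)
    obtain ⟨e, he, h'⟩ := exists_lt_of_lt_csSup hD (hs n n.lt_succ_self)
    rcases le_total d e with hde | hde
    · refine ⟨e, he, fun i hi => ?_⟩
      rcases Nat.lt_succ_iff_lt_or_eq.1 hi with hi | rfl
      exacts [(h i hi).trans_le hde, h']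
    · refine ⟨d, hd, fun i hi => ?_⟩
      rcases Nat.lt_succ_iff_lt_or_eq.1 hi with hi | rfl
      exacts [h i hi, h'.trans_le hde]

/-- If `sSup D` avoids the closed set attached to its height, then so does every ordinal in an
interval `[d, sSup D]` with `d ∈ D`. -/
theorem exists_mem_forall_notMem_of_isClosed {s : ℕ → Ordinal.{u}} {C : ℕ → Set Ordinal.{u}}
    (hC : ∀ n, IsClosed (C n)) {D : Set Ordinal.{u}} (hD : D.Nonempty)
    (hk : ∃ k, sSup D ≤ s k) (hnot : sSup D ∉ C (height s (sSup D))) :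
    ∃ d ∈ D, ∀ b, d ≤ b → b ≤ sSup D → b ∉ C (height s b) := by
  by_cases hmem : sSup D ∈ D
  · refine ⟨_, hmem, fun b h1 h2 => ?_⟩
    rwa [le_antisymm h2 h1]
  -- The point sought lies above two bounds: the terms of `s` before the height of `sSup D`, which
  -- makes the height constant up to `sSup D`, and the left end of a neighbourhood missing the
  -- closed set.
  have hnhds := (hC (height s (sSup D))).isOpen_compl.mem_nhds hnot
  obtain ⟨d₀, hd₀⟩ := hD
  by_cases hlt : d₀ < sSup D
  · obtain ⟨l, hl, hlsub⟩ := exists_Ioc_subset_of_mem_nhds hnhds ⟨d₀, hlt⟩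
    obtain ⟨d, hd, hds⟩ := exists_forall_lt_of_lt_sSup ⟨d₀, hd₀⟩ s (height s (sSup D))
      fun i hi => apply_lt_of_lt_height hi
    obtain ⟨e, he, hle⟩ := exists_lt_of_lt_csSup ⟨d₀, hd₀⟩ hl
    have key : ∀ f, d ≤ f → e ≤ f → ∀ b, f ≤ b → b ≤ sSup D → b ∉ C (height s b) := by
      intro f hdf hef b hfb hb
      have hheight : height s b = height s (sSup D) := by
        refine le_antisymm (height_mono hb hk) ?_
        by_contra! h
        exact ((hds _ h).trans_le (hdf.trans hfb)).not_ge
          (le_apply_height (hk.imp fun k hk => hb.trans hk))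
      rw [hheight]
      exact hlsub ⟨hle.trans_le (hef.trans hfb), hb⟩
    rcases le_total d e with hde | hde
    · exact ⟨e, he, key e hde le_rfl⟩
    · exact ⟨d, hd, key d le_rfl hde⟩
  -- `D` need not be bounded; here `sSup D ≤ d₀`, so the interval has at most one point.
  · refine ⟨d₀, hd₀, fun b h1 h2 => ?_⟩
    rwa [le_antisymm h2 ((not_lt.1 hlt).trans h1)]

/-! ### The combinatorial contradiction. -/

/-- If `ω₁` is a union of countably many sets, one of them has a limit point below `ω₁`. -/
theorem exists_isSuccLimit_forall_exists_mem (T : ℕ → Set Ordinal.{u})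
    (hT : ∀ ξ < ω₁, ∃ n, ξ ∈ T n) :
    ∃ n, ∃ ξ < (ω₁ : Ordinal.{u}), Order.IsSuccLimit ξ ∧ ∀ η < ξ, ∃ ζ ∈ T n, η < ζ ∧ ζ < ξ := by
  obtain ⟨n, hn⟩ : ∃ n, ∀ b < (ω₁ : Ordinal.{u}), ∃ ζ ∈ T n, ζ < ω₁ ∧ b < ζ := by
    by_contra! h
    choose b hb hbT using h
    -- If each `T n` were bounded by `b n`, the successor of the supremum of these bounds would lie
    -- in no `T n`.
    obtain ⟨n, hn⟩ := hT (Order.succ (⨆ n, b n))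
      ((Cardinal.isSuccLimit_omega 1).succ_lt (Ordinal.iSup_lt_omega_one hb))
    have h1 := hbT n _ hn ((Cardinal.isSuccLimit_omega 1).succ_lt (Ordinal.iSup_lt_omega_one hb))
    exact (Order.lt_succ_of_le (Ordinal.le_iSup b n)).not_ge h1
  choose! f hfT hfω hf using hn
  let t : ℕ → Ordinal.{u} := fun k => f^[k + 1] 0
  have htsucc : ∀ k, t (k + 1) = f (t k) := fun k => Function.iterate_succ_apply' f (k + 1) 0
  have htω : ∀ k, t k < ω₁ := by
    intro k
    induction k with
    | zero => exact hfω 0 (Ordinal.omega_pos 1)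
    | succ k ih => rw [htsucc]; exact hfω _ ih
  have htlt : ∀ k, t k < t (k + 1) := fun k => by rw [htsucc]; exact hf _ (htω k)
  have hlt : ∀ k, t k < ⨆ k, t k := fun k => (htlt k).trans_le (Ordinal.le_iSup t (k + 1))
  refine ⟨n, ⨆ k, t k, Ordinal.iSup_lt_omega_one htω, ⟨?_, ?_⟩, fun η hη => ?_⟩
  · exact not_isMin_of_lt (hlt 0)
  · refine Order.isSuccPrelimit_of_succ_lt fun a ha => ?_
    obtain ⟨k, hk⟩ := Ordinal.lt_iSup_iff.1 ha
    exact (Order.succ_le_of_lt hk).trans_lt (hlt k)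
  · obtain ⟨k, hk⟩ := Ordinal.lt_iSup_iff.1 hη
    refine ⟨t (k + 1), ?_, hk.trans (htlt k), hlt _⟩
    rw [htsucc]
    exact hfT _ (htω k)

/-- The combinatorial core: no strictly increasing `ω₁`-sequence `δ` avoids a covering matrix at
all its limit points in the way that a reflecting sequence does. -/
theorem false_of_reflection {κ : Cardinal.{u}} (hκ : ℵ₁ < κ)
    {K : Ordinal.{u} → Ordinal.{u} → Set Ordinal.{u}} (hK : IsCoveringMatrix ℵ₀ κ K)
    (δ : Ordinal.{u} → Ordinal.{u}) (hδκ : ∀ ξ < ω₁, δ ξ < κ.ord)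
    (hδ : ∀ η ξ, η < ξ → ξ < ω₁ → δ η < δ ξ)
    (D : Ordinal.{u} → Set Ordinal.{u}) (s : Ordinal.{u} → ℕ → Ordinal.{u})
    (γ : Ordinal.{u} → Ordinal.{u}) (hγ : ∀ ξ < ω₁, γ ξ < κ.ord)
    (hδD : ∀ η ξ, η < ξ → ξ < ω₁ → δ η ∈ D ξ)
    (htrace : ∀ ξ < ω₁, ∀ β < κ.ord, ∀ n : ℕ, ∃ m : ℕ, K n β ∩ D ξ ⊆ K m (γ ξ))
    (hDs : ∀ ξ < ω₁, ∀ a ∈ D ξ, ∃ k, a ≤ s ξ k)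
    (hsδ : ∀ ξ < ω₁, Order.IsSuccLimit ξ → ∀ i, ∃ η < ξ, s ξ i ≤ δ η)
    (hreflect : ∀ ξ < ω₁, Order.IsSuccLimit ξ → ∃ ν < ξ, ∀ η, ν < η → η < ξ →
      δ η ∉ K (height (s ξ) (δ η)) (γ ξ)) : False := by
  have hω : ∀ n : ℕ, (n : Ordinal.{u}) < (ℵ₀ : Cardinal.{u}).ord := fun n => by
    rw [ord_aleph0]; exact natCast_lt_omega0 n
  have hΔ : sSup (δ '' Iio ω₁) < κ.ord := by
    refine sSup_lt_ord_of_isRegular hK.regular_right ?_ (mk_image_le.trans_lt ?_)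
    · rintro _ ⟨ξ, hξ, rfl⟩
      exact hδκ ξ hξ
    · rw [Cardinal.mk_Iio_ordinal, card_omega, Cardinal.lift_lt]
      exact hκ
  -- The successor is needed because column `β` covers only ordinals strictly below `β`.
  have hβ : Order.succ (sSup (δ '' Iio ω₁)) < κ.ord :=
    (isSuccLimit_ord hK.regular_right.aleph0_le).succ_lt hΔ
  obtain ⟨n, ξ, hξω, hξ, hξT⟩ := exists_isSuccLimit_forall_exists_mem
    (fun n => {ξ | δ ξ ∈ K n (Order.succ (sSup (δ '' Iio ω₁)))}) fun ξ hξ => by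
      have hle : δ ξ ≤ sSup (δ '' Iio ω₁) := by
        refine le_csSup ⟨κ.ord, ?_⟩ ⟨ξ, hξ, rfl⟩
        rintro _ ⟨η, hη, rfl⟩
        exact (hδκ η hη).le
      obtain ⟨α, hα, h⟩ := hK.cover _ hβ _ (Order.lt_succ_of_le hle)
      rw [ord_aleph0, lt_omega0] at hα
      obtain ⟨n, rfl⟩ := hα
      exact ⟨n, h⟩
  obtain ⟨m, hm⟩ := htrace ξ hξω _ hβ n
  obtain ⟨ν, hν, hνξ⟩ := hreflect ξ hξω hξ
  -- Each term of `s ξ` is overtaken by some `δ η` with `η < ξ`; finitely many are overtaken at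
  -- once, so heights of `δ ζ` are unbounded as `ζ` approaches `ξ`.
  have hbound : ∀ j, ∃ η < ξ, ν ≤ η ∧ ∀ i < j, s ξ i ≤ δ η := by
    intro j
    induction j with
    | zero => exact ⟨ν, hν, le_rfl, by simp⟩
    | succ j ih =>
      obtain ⟨η, hη, hνη, h⟩ := ih
      obtain ⟨η', hη', h'⟩ := hsδ ξ hξω hξ j
      have hmax : max η η' < ξ := max_lt hη hη'
      have hmono : ∀ ζ ≤ max η η', δ ζ ≤ δ (max η η') := fun ζ hζ => by
        rcases hζ.eq_or_lt with rfl | hζ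
        exacts [le_rfl, (hδ _ _ hζ (hmax.trans hξω)).le]
      refine ⟨max η η', hmax, hνη.trans (le_max_left _ _), fun i hi => ?_⟩
      rcases Nat.lt_succ_iff_lt_or_eq.1 hi with hi | rfl
      exacts [(h i hi).trans (hmono _ (le_max_left _ _)), h'.trans (hmono _ (le_max_right _ _))]
  obtain ⟨η, hη, hνη, hs⟩ := hbound (m + 1)
  obtain ⟨ζ, hζT, hηζ, hζξ⟩ := hξT η hη
  have hζD := hδD ζ ξ hζξ hξω
  have hheight : m < height (s ξ) (δ ζ) := lt_height (hDs ξ hξω _ hζD) fun i hi =>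
    (hs i (Nat.lt_succ_of_le hi)).trans_lt (hδ _ _ hηζ (hζξ.trans hξω))
  exact hνξ ζ (hνη.trans_lt hηζ) hζξ
    (hK.mono _ (hγ ξ hξω) _ _ (Nat.cast_lt.2 hheight) (hω _) (hm ⟨hζT, hζD⟩))

/-! ### Clubs of countable subsets of `κ` and their suprema. -/

/-- The ordinals whose von Neumann representative belongs to `Y`. -/
def ordTrace (Y : ZFSet.{u}) : Set Ordinal.{u} :=
  {a | a.toZFSet ∈ Y}

theorem mem_ordTrace {Y : ZFSet.{u}} {a : Ordinal.{u}} : a ∈ ordTrace Y ↔ a.toZFSet ∈ Y :=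
  Iff.rfl

theorem mem_ordTrace_inter {Y : ZFSet.{u}} {a o : Ordinal.{u}} :
    a ∈ ordTrace (Y ∩ o.toZFSet) ↔ a.toZFSet ∈ Y ∧ a < o := by
  rw [mem_ordTrace, ZFSet.mem_inter, toZFSet_mem_toZFSet_iff]

theorem countable_ordTrace {Y : ZFSet.{u}} (hY : (Y : Set ZFSet.{u}).Countable) :
    (ordTrace Y).Countable :=
  hY.preimage toZFSet_injective

theorem ordTrace_subset_Iio {Y : ZFSet.{u}} {o : Ordinal.{u}}
    (hY : (Y : Set ZFSet.{u}) ⊆ (o.toZFSet : Set ZFSet.{u})) : ordTrace Y ⊆ Iio o := fun a ha =>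
  toZFSet_mem_toZFSet_iff.1 (show a.toZFSet ∈ o.toZFSet from hY ha)

theorem ordTrace_nonempty {Y : ZFSet.{u}} {o : Ordinal.{u}}
    (hY : Y ∈ omegaSubsets (o.toZFSet : Set ZFSet.{u})) : (ordTrace Y).Nonempty := by
  rw [mem_omegaSubsets] at hY
  obtain ⟨z, hz⟩ := hY.2.2.nonempty
  obtain ⟨a, -, rfl⟩ := mem_toZFSet_iff.1 (show z ∈ o.toZFSet from hY.1 hz)
  exact ⟨a, hz⟩

theorem sSup_ordTrace_lt {κ : Cardinal.{u}} (hκ : κ.IsRegular) (hκ' : ℵ₀ < κ) {Y : ZFSet.{u}}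
    (hY : (Y : Set ZFSet.{u}).Countable)
    (hY' : (Y : Set ZFSet.{u}) ⊆ (κ.ord.toZFSet : Set ZFSet.{u})) :
    sSup (ordTrace Y) < κ.ord := by
  refine sSup_lt_ord_of_isRegular hκ (ordTrace_subset_Iio hY') ?_
  refine (Cardinal.le_aleph0_iff_set_countable.2 (countable_ordTrace hY)).trans_lt ?_
  rwa [← Cardinal.lift_aleph0.{u + 1, u}, Cardinal.lift_lt]

/-- The infinite set `{α + 1, α + 2, …}` is contained in some member of the club. -/
theorem exists_mem_club_lt_sSup {κ : Cardinal.{u}} (hκ : ℵ₀ ≤ κ) {E : Set ZFSet.{u}}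
    (hE : IsClubIn (κ.ord.toZFSet : Set ZFSet.{u}) E) {α : Ordinal.{u}} (hα : α < κ.ord) :
    ∃ Y ∈ E, α < sSup (ordTrace Y) := by
  have hlim := isSuccLimit_ord hκ
  let f : ℕ → Ordinal.{u} := fun n => Order.succ^[n + 1] α
  have hsucc : ∀ n, f (n + 1) = Order.succ (f n) := fun n => Function.iterate_succ_apply' _ _ _
  have hf : ∀ n, f n < κ.ord := by
    intro n
    induction n with
    | zero => exact hlim.succ_lt hα
    | succ n ih => rw [hsucc]; exact hlim.succ_lt ih
  have hmono : StrictMono f := strictMono_nat_of_lt_succ fun n => by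
    rw [hsucc]; exact Order.lt_succ _
  obtain ⟨Z, hZ⟩ := exists_coe_eq_of_countable (countable_range fun n => (f n).toZFSet)
  have hZ' : Z ∈ omegaSubsets (κ.ord.toZFSet : Set ZFSet.{u}) := by
    rw [mem_omegaSubsets, hZ]
    refine ⟨?_, countable_range _, infinite_range_of_injective
      (toZFSet_injective.comp hmono.injective)⟩
    rintro _ ⟨n, rfl⟩
    exact toZFSet_mem_toZFSet_iff.2 (hf n)
  obtain ⟨Y, hY, hZY⟩ := hE.unbounded Z hZ'
  refine ⟨Y, hY, (Order.lt_succ α).trans_le ?_⟩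
  refine le_csSup (bddAbove_of_subset_Iio (ordTrace_subset_Iio (hE.subset hY).1)) (mem_ordTrace.2 (hZY ?_))
  have h : (Order.succ α).toZFSet ∈ (Z : Set ZFSet.{u}) := by
    rw [hZ]
    exact ⟨0, rfl⟩
  exact h

/-- If no unbounded set is covered, every club contains a sequence whose suprema are not
covered. -/
theorem exists_sequence_of_not_covered {κ : Cardinal.{u}} (hκ : ℵ₀ < κ) (hκr : κ.IsRegular)
    {K : Ordinal.{u} → Ordinal.{u} → Set Ordinal.{u}}
    (hno : ∀ A : Set Ordinal.{u}, A ⊆ Iio κ.ord → (∀ α < κ.ord, ∃ ξ ∈ A, α < ξ) →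
      ∃ X ⊆ A, #X = ℵ₀ ∧ ∀ m : ℕ, ∀ β < κ.ord, ¬X ⊆ K m β)
    {E : Set ZFSet.{u}} (hE : IsClubIn (κ.ord.toZFSet : Set ZFSet.{u}) E) :
    ∃ B : ℕ → ZFSet.{u}, (∀ n, B n ∈ E) ∧
      ∀ m : ℕ, ∀ β < κ.ord, ∃ n, sSup (ordTrace (B n)) ∉ K m β := by
  have hlt : ∀ Y ∈ E, sSup (ordTrace Y) < κ.ord := fun Y hY => by
    have h := mem_omegaSubsets.1 (hE.subset hY)
    exact sSup_ordTrace_lt hκr hκ h.2.1 h.1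
  -- The non-covering assumption is applied to the set of suprema of members of `E`.
  obtain ⟨X, hXA, hX, hXK⟩ := hno ((fun Y => sSup (ordTrace Y)) '' E)
    (by rintro _ ⟨Y, hY, rfl⟩; exact hlt Y hY)
    (fun α hα => by
      obtain ⟨Y, hY, h⟩ := exists_mem_club_lt_sSup hκ.le hE hα
      exact ⟨_, ⟨Y, hY, rfl⟩, h⟩)
  have hne : X.Nonempty := by
    rw [← Set.nonempty_coe_sort, ← Cardinal.mk_ne_zero_iff, hX]
    exact aleph0_ne_zero
  obtain ⟨f, rfl⟩ := (Cardinal.le_aleph0_iff_set_countable.1 hX.le).exists_eq_range hne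
  choose B hBE hB using fun n => hXA (mem_range_self n)
  refine ⟨B, hBE, fun m β hβ => ?_⟩
  obtain ⟨_, ⟨n, rfl⟩, hn⟩ := Set.not_subset.1 (hXK m β hβ)
  refine ⟨n, ?_⟩
  rw [← hB n] at hn
  exact hn

/-! ### The open set mapping attached to a covering matrix. -/

/-- The sets `Y ∈ [κ]^ω` bounded by a term of `s` and whose supremum avoids the closed set
attached to its height. -/
def avoidingSets (κ : Cardinal.{u}) (s : ℕ → Ordinal.{u}) (C : ℕ → Set Ordinal.{u}) :
    Set ZFSet.{u} :=
  {Y | Y ∈ omegaSubsets (κ.ord.toZFSet : Set ZFSet.{u}) ∧ (∃ k, sSup (ordTrace Y) ≤ s k) ∧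
    sSup (ordTrace Y) ∉ C (height s (sSup (ordTrace Y)))}

/-- Around `Y` the basic set `[{d}, Y]` works for a suitable `d ∈ Y`: its members have supremum in
`[d, sup Y]`, where the closed sets are still avoided. -/
theorem isEllentuckOpen_avoidingSets (κ : Cardinal.{u}) (s : ℕ → Ordinal.{u})
    {C : ℕ → Set Ordinal.{u}} (hC : ∀ n, IsClosed (C n)) :
    IsEllentuckOpen κ.ord.toZFSet (avoidingSets κ s C) := by
  refine ⟨{b | (∃ N ∈ omegaSubsets (κ.ord.toZFSet : Set ZFSet.{u}), ∃ x : Set ZFSet.{u},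
    x.Finite ∧ x ⊆ (N : Set ZFSet.{u}) ∧ b = ellentuckBasic κ.ord.toZFSet x N) ∧
      b ⊆ avoidingSets κ s C}, fun b hb => hb.1, ?_⟩
  refine Subset.antisymm (fun Y hY => ?_) (sUnion_subset fun b hb => hb.2)
  obtain ⟨hYω, hk, hnot⟩ := hY
  obtain ⟨d, hd, h⟩ := exists_mem_forall_notMem_of_isClosed hC (ordTrace_nonempty hYω) hk hnot
  refine ⟨ellentuckBasic κ.ord.toZFSet {d.toZFSet} Y, ⟨⟨Y, hYω, _, finite_singleton _,
    singleton_subset_iff.2 hd, rfl⟩, ?_⟩, hYω, singleton_subset_iff.2 hd, fun _ hz => hz⟩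
  rintro Z ⟨hZω, hdZ, hZY⟩
  have hle : sSup (ordTrace Z) ≤ sSup (ordTrace Y) :=
    csSup_le_csSup (bddAbove_of_subset_Iio (ordTrace_subset_Iio hYω.1)) (ordTrace_nonempty hZω)
      fun a ha => mem_ordTrace.2 (hZY ha)
  refine ⟨hZω, hk.imp fun k hk => hle.trans hk, h _ ?_ hle⟩
  exact le_csSup (bddAbove_of_subset_Iio (ordTrace_subset_Iio hZω.1)) 
    (mem_ordTrace.2 (singleton_subset_iff.1 hdZ))

theorem exists_isRegular_mem_H_omegaPowerset (X : ZFSet.{u}) :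
    ∃ θ : Cardinal.{u}, θ.IsRegular ∧ omegaPowerset X ∈ H θ ∧ X ∈ H θ := by
  obtain ⟨θ, hθ, h⟩ := exists_isRegular_mem_H {omegaPowerset X, X}
  exact ⟨θ, hθ, mem_H_of_mem h (by simp), mem_H_of_mem h (by simp)⟩

theorem mem_omegaPowerset {X Y : ZFSet.{u}} :
    Y ∈ omegaPowerset X ↔ Y ∈ omegaSubsets (X : Set ZFSet.{u}) := by
  rw [omegaPowerset, ZFSet.mem_sep, ZFSet.mem_powerset, omegaSubsets, mem_ofPred_eq,
    ZFSet.coe_subset_coe]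

/-- A covering matrix has at each countable set of ordinals a column tracing the whole matrix and
an enumeration of the set. -/
theorem exists_column_and_enumeration {κ : Cardinal.{u}}
    {K : Ordinal.{u} → Ordinal.{u} → Set Ordinal.{u}} (hK : IsCoveringMatrix ℵ₀ κ K)
    {D : Set Ordinal.{u}} (hD : D ⊆ Iio κ.ord) (hc : D.Countable) (hne : D.Nonempty) :
    ∃ (s : ℕ → Ordinal.{u}) (γ : Ordinal.{u}), D = range s ∧ γ < κ.ord ∧
      ∀ β < κ.ord, ∀ n : ℕ, ∃ m : ℕ, K n β ∩ D ⊆ K m γ := by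
  obtain ⟨s, hs⟩ := hc.exists_eq_range hne
  obtain ⟨γ, hγ, h⟩ := hK.trace D hD (by
    rw [Cardinal.lift_aleph0]
    exact Cardinal.le_aleph0_iff_set_countable.2 hc)
  refine ⟨s, γ, hs, hγ, fun β hβ n => ?_⟩
  obtain ⟨α, hα, h'⟩ := h β hβ n (by rw [ord_aleph0]; exact natCast_lt_omega0 n)
  rw [ord_aleph0, lt_omega0] at hα
  obtain ⟨m, rfl⟩ := hα
  exact ⟨m, h'⟩

/-! ### Stationarity, reflection and the conclusion. -/

/-- Under `MRP`, a covering matrix with closed entries covers some unbounded set. -/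
theorem not_forall_unbounded_not_covered (hMRP : MRP.{u}) {κ : Cardinal.{u}} (hκ : ℵ₁ < κ)
    {K : Ordinal.{u} → Ordinal.{u} → Set Ordinal.{u}} (hK : IsCoveringMatrix ℵ₀ κ K)
    (hclosed : ∀ n : ℕ, ∀ β < κ.ord, IsClosed (K n β))
    (hno : ∀ A : Set Ordinal.{u}, A ⊆ Iio κ.ord → (∀ α < κ.ord, ∃ ξ ∈ A, α < ξ) →
      ∃ X ⊆ A, #X = ℵ₀ ∧ ∀ m : ℕ, ∀ β < κ.ord, ¬X ⊆ K m β) : False := by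
  have hreg := hK.regular_right
  have hκ₀ : ℵ₀ < κ := hK.lt
  have hlim := isSuccLimit_ord hκ₀.le
  set X : ZFSet.{u} := κ.ord.toZFSet with hX
  obtain ⟨θ, hθ, hPX, hXH⟩ := exists_isRegular_mem_H_omegaPowerset X
  have hordH : ∀ a < κ.ord, a.toZFSet ∈ H θ := fun a ha =>
    mem_H_of_mem hXH (toZFSet_mem_toZFSet_iff.2 ha)
  have hB : ∀ E : ZFSet.{u}, ∃ B : ℕ → ZFSet.{u},
      IsClubIn (X : Set ZFSet.{u}) (E : Set ZFSet.{u}) → (∀ n, B n ∈ E) ∧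
        ∀ m : ℕ, ∀ β < κ.ord, ∃ n, sSup (ordTrace (B n)) ∉ K m β := by
    intro E
    by_cases hE : IsClubIn (X : Set ZFSet.{u}) (E : Set ZFSet.{u})
    · obtain ⟨B, hB⟩ := exists_sequence_of_not_covered hκ₀ hreg hno hE
      exact ⟨B, fun _ => hB⟩
    · exact ⟨fun _ => ∅, fun h => (hE h).elim⟩
  choose B hB using hB
  let δ : ZFSet.{u} → Ordinal.{u} := fun M => sSup (ordTrace (M ∩ X))
  let τ : ZFSet.{u} → Ordinal.{u} := fun E => ⨆ n, sSup (ordTrace (B E n))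
  -- Closure under these functions replaces definability arguments. Zero makes `M ∩ κ` nonempty, `δ`
  -- and its successor make the suprema along the chain strictly increasing and members of later
  -- models, and `τ` and `B` serve stationarity.
  let Φ : ℕ → ZFSet.{u} → ZFSet.{u}
    | 0, _ => X
    | 1, _ => toZFSet 0
    | 2, x => (δ x).toZFSet
    | 3, x => (Order.succ (δ x)).toZFSet
    | 4, x => (τ x).toZFSet
    | n + 5, x => B x n
  obtain ⟨dom, hclub, hdom⟩ := exists_club_elementary θ ⟨X, hXH⟩ Φ
  have hΦ : ∀ M ∈ dom, ∀ x ∈ M, ∀ i, Φ i x ∈ H θ → Φ i x ∈ M := fun M hM => (hdom M hM).2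
  have hdomω : ∀ M ∈ dom, (M : Set ZFSet.{u}).Countable ∧ (M : Set ZFSet.{u}).Infinite :=
    fun M hM => (mem_omegaSubsets.1 (hclub.subset hM)).2
  have hXM : ∀ M ∈ dom, X ∈ M := fun M hM => by
    obtain ⟨x, hx⟩ := (hdomω M hM).2.nonempty
    exact hΦ M hM x hx 0 hXH
  have hinter : ∀ M ∈ dom, ((M ∩ X : ZFSet.{u}) : Set ZFSet.{u}).Countable := fun M hM =>
    (hdomω M hM).1.mono fun z hz => (ZFSet.mem_inter.1 hz).1
  have hinterX : ∀ M : ZFSet.{u}, ((M ∩ X : ZFSet.{u}) : Set ZFSet.{u}) ⊆ X := fun M z hz =>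
    (ZFSet.mem_inter.1 hz).2
  have hδκ : ∀ M ∈ dom, δ M < κ.ord := fun M hM =>
    sSup_ordTrace_lt hreg hκ₀ (hinter M hM) (hinterX M)
  have hle : ∀ M : ZFSet.{u}, ∀ a ∈ ordTrace (M ∩ X), a ≤ δ M := fun M a ha =>
    le_csSup (bddAbove_of_subset_Iio (ordTrace_subset_Iio (hinterX M))) ha
  have hcol : ∀ M ∈ dom, ∃ (s : ℕ → Ordinal.{u}) (γ : Ordinal.{u}),
      ordTrace (M ∩ X) = range s ∧ γ < κ.ord ∧
        ∀ β < κ.ord, ∀ n : ℕ, ∃ m : ℕ, K n β ∩ ordTrace (M ∩ X) ⊆ K m γ := fun M hM =>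
    exists_column_and_enumeration hK (ordTrace_subset_Iio (hinterX M))
      (countable_ordTrace (hinter M hM))
      ⟨0, mem_ordTrace_inter.2 ⟨hΦ M hM X (hXM M hM) 1 (hordH 0 hreg.ord_pos), hreg.ord_pos⟩⟩
  choose! s γ hs hγ htrace using hcol
  have hmemκ : ∀ E : ZFSet.{u}, IsClubIn (X : Set ZFSet.{u}) (E : Set ZFSet.{u}) →
      ∀ n, B E n ∈ omegaSubsets (X : Set ZFSet.{u}) := fun E hE n => hE.subset ((hB E hE).1 n)
  have hsupB : ∀ E : ZFSet.{u}, IsClubIn (X : Set ZFSet.{u}) (E : Set ZFSet.{u}) →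
      ∀ n, sSup (ordTrace (B E n)) < κ.ord := fun E hE n => by
    have h := mem_omegaSubsets.1 (hmemκ E hE n)
    exact sSup_ordTrace_lt hreg hκ₀ h.2.1 h.1
  have hτ : ∀ E : ZFSet.{u}, IsClubIn (X : Set ZFSet.{u}) (E : Set ZFSet.{u}) → τ E < κ.ord := by
    intro E hE
    refine sSup_lt_ord_of_isRegular hreg (range_subset_iff.2 (hsupB E hE)) ?_
    refine (Cardinal.le_aleph0_iff_set_countable.2 (countable_range _)).trans_lt ?_
    rwa [← Cardinal.lift_aleph0.{u + 1, u}, Cardinal.lift_lt]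
  have hmap : IsOpenStationaryMapping X θ dom
      fun M => avoidingSets κ (s M) fun n => K n (γ M) := by
    refine ⟨?_, hθ, hPX, hclub, fun M hM => (hdom M hM).1, hXM, fun M _ Y hY => hY.1,
      fun M hM => isEllentuckOpen_avoidingSets κ _ fun n => hclosed n _ (hγ M hM), ?_⟩
    · rwa [hX, card_toZFSet, card_ord]
    · intro M hM E hEM hE
      obtain ⟨k, hk⟩ : ∃ k, τ E ≤ s M k := by
        have h : τ E ∈ ordTrace (M ∩ X) :=
          mem_ordTrace_inter.2 ⟨hΦ M hM E hEM 4 (hordH _ (hτ E hE)), hτ E hE⟩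
        rw [hs M hM] at h
        obtain ⟨k, hk⟩ := h
        exact ⟨k, hk.ge⟩
      -- The height of `τ E` bounds the heights of all the suprema, so it can be fixed before `n` is
      -- chosen.
      obtain ⟨n, hn⟩ := (hB E hE).2 (height (s M) (τ E)) (γ M) (hγ M hM)
      have hn' : sSup (ordTrace (B E n)) ≤ τ E := 
        Ordinal.le_iSup (fun n => sSup (ordTrace (B E n))) n
      refine ⟨B E n, ⟨hmemκ E hE n, ⟨k, hn'.trans hk⟩, fun h => hn ?_⟩, (hB E hE).1 n,
        hΦ M hM E hEM (n + 5) (mem_H_of_mem hPX (mem_omegaPowerset.2 (hmemκ E hE n)))⟩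
      rcases (height_mono hn' ⟨k, hk⟩).eq_or_lt with heq | hlt
      · rwa [← heq]
      · exact hK.mono _ (hγ M hM) _ _ (Nat.cast_lt.2 hlt)
          (by rw [ord_aleph0]; exact natCast_lt_omega0 _) h
  obtain ⟨N, hN⟩ := hMRP X θ dom _ hmap
  have hδN : ∀ η ξ, η < ξ → ξ < ω₁ → δ (N η) ∈ ordTrace (N ξ ∩ X) := fun η ξ hηξ hξ => by
    have h := hδκ _ (hN.mem_dom η (hηξ.trans hξ))
    exact mem_ordTrace_inter.2
      ⟨hΦ _ (hN.mem_dom ξ hξ) _ (hN.chain η ξ hηξ hξ) 2 (hordH _ h), h⟩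
  have hrange : ∀ ξ < ω₁, ∀ a ∈ ordTrace (N ξ ∩ X), ∃ k, a ≤ s (N ξ) k := fun ξ hξ a ha => by
    rw [hs _ (hN.mem_dom ξ hξ)] at ha
    obtain ⟨k, hk⟩ := ha
    exact ⟨k, hk.ge⟩
  refine false_of_reflection hκ hK (fun ξ => δ (N ξ)) (fun ξ hξ => hδκ _ (hN.mem_dom ξ hξ)) ?_
    (fun ξ => ordTrace (N ξ ∩ X)) (fun ξ => s (N ξ)) (fun ξ => γ (N ξ))
    (fun ξ hξ => hγ _ (hN.mem_dom ξ hξ)) hδN (fun ξ hξ => htrace _ (hN.mem_dom ξ hξ)) hrange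
    ?_ ?_
  · intro η ξ hηξ hξ
    -- The successor of `δ (N η)` belongs to `N ξ`, which gives the strict inequality.
    have h := hlim.succ_lt (hδκ _ (hN.mem_dom η (hηξ.trans hξ)))
    exact Order.succ_le_iff.1 (hle _ _ (mem_ordTrace_inter.2
      ⟨hΦ _ (hN.mem_dom ξ hξ) _ (hN.chain η ξ hηξ hξ) 3 (hordH _ h), h⟩))
  · intro ξ hξ hξlim i
    have h : s (N ξ) i ∈ ordTrace (N ξ ∩ X) := by
      rw [hs _ (hN.mem_dom ξ hξ)]
      exact mem_range_self i
    obtain ⟨h1, h2⟩ := mem_ordTrace_inter.1 h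
    obtain ⟨η, hη, h3⟩ := (hN.continuous ξ hξ hξlim _).1 h1
    -- By continuity, each term of `s (N ξ)` already belongs to some earlier `N η`, hence is at most
    -- `δ (N η)`.
    exact ⟨η, hη, hle _ _ (mem_ordTrace_inter.2 ⟨h3, h2⟩)⟩
  · intro ξ hξ hξlim
    obtain ⟨ν, hν, h⟩ := hN.reflects ξ hξ hξlim
    exact ⟨ν, hν, fun η h1 h2 => (h η h1 h2).2.2⟩

end ReflectionCovering

theorem mainTheorem3 (hMRP : ReflectionCovering.MRP.{u}) (κ : Cardinal.{u}) (hκ : ℵ₁ < κ)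
    (K : Ordinal.{u} → Ordinal.{u} → Set Ordinal.{u})
    (hK : ReflectionCovering.IsCoveringMatrix ℵ₀ κ K)
    (hclosed : ∀ n < (ℵ₀ : Cardinal.{u}).ord, ∀ β < κ.ord, IsClosed (K n β)) :
    ∃ A : Set Ordinal.{u}, A ⊆ Set.Iio κ.ord ∧ (∀ α < κ.ord, ∃ ξ ∈ A, α < ξ) ∧
      ∀ X : Set Ordinal.{u}, X ⊆ A → #X = ℵ₀ →
        ∃ n < (ℵ₀ : Cardinal.{u}).ord, ∃ β < κ.ord, X ⊆ K n β := by
  have hω : ∀ n : ℕ, (n : Ordinal.{u}) < (ℵ₀ : Cardinal.{u}).ord := fun n => by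
    rw [ord_aleph0]; exact natCast_lt_omega0 n
  by_contra! hno
  refine ReflectionCovering.not_forall_unbounded_not_covered hMRP hκ hK
    (fun n => hclosed n (hω n)) fun A hA hA' => ?_
  obtain ⟨X, hXA, hX, h⟩ := hno A hA hA'
  exact ⟨X, hXA, hX, fun m => h m (hω m)⟩
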